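/- Let $K$ be a field, let $Q$ be a quiver with finitely many vertices, and let $I$ be an admissible ideal of the path algebra $KQ$ (that is, $J_Q^N\subseteq I\subseteq J_Q^2$ for some $N\ge 2$, where $J_Q$ is the ideal generated by the arrows) which is monomial, i.e. generated by a set of paths, and such that $\Lambda=KQ/I$ is finite dimensional over $K$. Let $\mathcal T$ be the minimal set of paths generating $I$. A two-sided ideal $L$ of a ring $R$ with Jacobson radical $J(R)$ is called heredity if $L^2=L$, $L\,J(R)\,L=0$, and $L$ is projective as a left or as a right $R$-module; $R$ is called quasi-hereditary if there is a finite chain of two-sided ideals $0=L_0\subseteq L_1\subseteq\dots\subseteq L_m=R$ such that $L_i/L_{i-1}$ is a heredity ideal of $R/L_{i-1}$ for all $1\le i\le m$. A vertex $v$ is called properly internal to a path $t$ if $t=p_1p_2$ for paths $p_1$ and $p_2$ of length at least $1$ such that $p_1$ ends, and $p_2$ starts, at $v$. Then $\Lambda$ is quasi-hereditary if and only if all the vertices of $Q$ can be ordered $v_1,\dots,v_n$ (without repetition) in such a way that, for each $i=1,\dots,n$, the vertex $v_i$ is not properly internal to any path $t\in\mathcal T$ that passes through none of the vertices $v_1,\dots,v_{i-1}$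 (where a path also passes through its start and end vertices). -/

import Mathlib

/-! ### Path algebras of quivers with finitely many vertices -/

/-- A (directed, finite) path of the quiver `V`, together with its origin and end vertex.
The paths of length zero are the vertices. -/
structure QPath (V : Type*) [Quiver V] where
  /-- the origin vertex -/
  src : V
  /-- the end vertex -/
  tgt : V
  /-- the path itself -/
  path : Quiver.Path src tgt

/-- The vertex `v` as a path of length zero. -/
def QPath.vertex {V : Type*} [Quiver V] (v : V) : QPath V := ⟨v, v, Quiver.Path.nil⟩

/-- The path algebra `K V` of the quiver `V`: the vector space with basis the set of paths. -/
def PathAlgebra (K V : Type*) [Field K] [Quiver V] := QPath V →₀ K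

namespace PathAlgebra

section

variable {K V : Type*} [Field K] [Quiver V]

noncomputable instance : AddCommGroup (PathAlgebra K V) :=
  inferInstanceAs (AddCommGroup (QPath V →₀ K))

noncomputable instance : Module K (PathAlgebra K V) :=
  inferInstanceAs (Module K (QPath V →₀ K))

variable (K) in
/-- A path as an element of the path algebra. -/
noncomputable def ofPath (p : QPath V) : PathAlgebra K V := Finsupp.single p (1 : K)

variable (K V) in
/-- The paths form a basis of the path algebra. -/
noncomputable def basis : Module.Basis (QPath V) K (PathAlgebra K V) :=
  Module.Basis.ofRepr (LinearEquiv.refl K (QPath V →₀ K))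

theorem basis_apply (p : QPath V) : basis K V p = ofPath K p := rfl

open Classical in
variable (K) in
/-- The product of two paths: their concatenation (first `p`, then `q`) if `p` ends where `q`
starts, and zero otherwise. -/
noncomputable def pathMul (p q : QPath V) : PathAlgebra K V :=
  if h : p.tgt = q.src then ofPath K ⟨p.src, q.tgt, (p.path.cast rfl h).comp q.path⟩ else 0

variable (K V) in
/-- The bilinear extension of `pathMul`. -/
noncomputable def mulHom : PathAlgebra K V →ₗ[K] PathAlgebra K V →ₗ[K] PathAlgebra K V :=
  (basis K V).constr K fun p => (basis K V).constr K fun q => pathMul K p q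

noncomputable instance : Mul (PathAlgebra K V) := ⟨fun x y => mulHom K V x y⟩

theorem mul_def (x y : PathAlgebra K V) : x * y = mulHom K V x y := rfl

theorem ofPath_mul_ofPath (p q : QPath V) : ofPath K p * ofPath K q = pathMul K p q := by
  rw [mul_def, mulHom, ← basis_apply, ← basis_apply, Module.Basis.constr_basis,
    Module.Basis.constr_basis]

theorem ofPath_mul_ofPath_of_comp {a b c : V} (p : Quiver.Path a b) (q : Quiver.Path b c) :
    ofPath K ⟨a, b, p⟩ * ofPath K ⟨b, c, q⟩ = ofPath K ⟨a, c, p.comp q⟩ := by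
  simp [ofPath_mul_ofPath, pathMul]

theorem ofPath_mul_ofPath_of_ne {p q : QPath V} (h : p.tgt ≠ q.src) :
    ofPath K p * ofPath K q = 0 := by
  simp [ofPath_mul_ofPath, pathMul, h]

/-- An additive and homogeneous property that holds for all paths holds for all elements. -/
theorem induction {P : PathAlgebra K V → Prop} (x : PathAlgebra K V) (zero : P 0)
    (add : ∀ x y, P x → P y → P (x + y)) (smul : ∀ (k : K) x, P x → P (k • x))
    (path : ∀ p, P (ofPath K p)) : P x := by
  have hx : x ∈ Submodule.span K (Set.range (basis K V)) := by
    rw [(basis K V).span_eq]; trivial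
  induction hx using Submodule.span_induction with
  | mem x h => obtain ⟨p, rfl⟩ := h; exact path p
  | zero => exact zero
  | add x y _ _ hx hy => exact add x y hx hy
  | smul k x _ hx => exact smul k x hx

protected theorem add_mul (x y z : PathAlgebra K V) : (x + y) * z = x * z + y * z := by
  simp [mul_def]

protected theorem mul_add (x y z : PathAlgebra K V) : x * (y + z) = x * y + x * z := by
  simp [mul_def]

protected theorem zero_mul (x : PathAlgebra K V) : 0 * x = 0 := by
  simp [mul_def]

protected theorem mul_zero (x : PathAlgebra K V) : x * 0 = 0 := by
  simp [mul_def]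

protected theorem smul_mul (k : K) (x y : PathAlgebra K V) : (k • x) * y = k • (x * y) := by
  simp [mul_def]

protected theorem mul_smul (k : K) (x y : PathAlgebra K V) : x * (k • y) = k • (x * y) := by
  simp [mul_def]

protected theorem mul_assoc (x y z : PathAlgebra K V) : x * y * z = x * (y * z) := by
  induction x using PathAlgebra.induction with
  | zero => simp only [PathAlgebra.zero_mul]
  | add x x' h h' => simp only [PathAlgebra.add_mul, h, h']
  | smul k x h => simp only [PathAlgebra.smul_mul, h]
  | path p =>
  induction y using PathAlgebra.induction with
  | zero => simp only [PathAlgebra.zero_mul, PathAlgebra.mul_zero]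
  | add x x' h h' => simp only [PathAlgebra.add_mul, PathAlgebra.mul_add, h, h']
  | smul k x h => simp only [PathAlgebra.smul_mul, PathAlgebra.mul_smul, h]
  | path q =>
  induction z using PathAlgebra.induction with
  | zero => simp only [PathAlgebra.mul_zero]
  | add x x' h h' => simp only [PathAlgebra.mul_add, h, h']
  | smul k x h => simp only [PathAlgebra.mul_smul, h]
  | path r =>
  obtain ⟨a, b, p⟩ := p
  obtain ⟨b', c, q⟩ := q
  obtain ⟨c', d, r⟩ := r
  by_cases hb : b = b'
  · subst hb
    by_cases hc : c = c'
    · subst hc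
      simp only [ofPath_mul_ofPath_of_comp, Quiver.Path.comp_assoc]
    · rw [ofPath_mul_ofPath_of_comp, ofPath_mul_ofPath_of_ne (p := ⟨a, c, _⟩) hc,
        ofPath_mul_ofPath_of_ne (p := ⟨b, c, _⟩) hc, PathAlgebra.mul_zero]
  · rw [ofPath_mul_ofPath_of_ne (p := ⟨a, b, p⟩) hb, PathAlgebra.zero_mul]
    by_cases hc : c = c'
    · subst hc
      rw [ofPath_mul_ofPath_of_comp, ofPath_mul_ofPath_of_ne (p := ⟨a, b, p⟩) hb]
    · rw [ofPath_mul_ofPath_of_ne (p := ⟨b', c, _⟩) hc, PathAlgebra.mul_zero]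

variable [Fintype V]

/-- The identity is the sum of all vertices. -/
noncomputable instance : One (PathAlgebra K V) := ⟨∑ v : V, ofPath K (QPath.vertex v)⟩

theorem one_def : (1 : PathAlgebra K V) = ∑ v : V, ofPath K (QPath.vertex v) := rfl

protected theorem one_mul (x : PathAlgebra K V) : 1 * x = x := by
  induction x using PathAlgebra.induction with
  | zero => exact PathAlgebra.mul_zero _
  | add x x' h h' => rw [PathAlgebra.mul_add, h, h']
  | smul k x h => rw [PathAlgebra.mul_smul, h]
  | path p =>
  obtain ⟨a, b, p⟩ := p
  rw [one_def, mul_def, map_sum, LinearMap.sum_apply, Finset.sum_eq_single a]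
  · rw [← mul_def, QPath.vertex, ofPath_mul_ofPath_of_comp, Quiver.Path.nil_comp]
  · intro v _ hv
    exact ofPath_mul_ofPath_of_ne hv
  · simp

protected theorem mul_one (x : PathAlgebra K V) : x * 1 = x := by
  induction x using PathAlgebra.induction with
  | zero => exact PathAlgebra.zero_mul _
  | add x x' h h' => rw [PathAlgebra.add_mul, h, h']
  | smul k x h => rw [PathAlgebra.smul_mul, h]
  | path p =>
  obtain ⟨a, b, p⟩ := p
  rw [one_def, mul_def, map_sum, Finset.sum_eq_single b]
  · rw [← mul_def, QPath.vertex, ofPath_mul_ofPath_of_comp, Quiver.Path.comp_nil]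
  · intro v _ hv
    exact ofPath_mul_ofPath_of_ne (Ne.symm hv)
  · simp

noncomputable instance : Ring (PathAlgebra K V) :=
  { (inferInstance : AddCommGroup (PathAlgebra K V)),
    (inferInstance : Mul (PathAlgebra K V)),
    (inferInstance : One (PathAlgebra K V)) with
    left_distrib := PathAlgebra.mul_add
    right_distrib := PathAlgebra.add_mul
    zero_mul := PathAlgebra.zero_mul
    mul_zero := PathAlgebra.mul_zero
    mul_assoc := PathAlgebra.mul_assoc
    one_mul := PathAlgebra.one_mul
    mul_one := PathAlgebra.mul_one }

noncomputable instance : Algebra K (PathAlgebra K V) :=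
  Algebra.ofModule PathAlgebra.smul_mul fun k x y => PathAlgebra.mul_smul k x y

variable (K) in
/-- The two-sided ideal generated by a set of paths. -/
noncomputable def pathIdeal (S : Set (QPath V)) : TwoSidedIdeal (PathAlgebra K V) :=
  TwoSidedIdeal.span (ofPath K '' S)

variable (K V) in
/-- The arrow ideal: the two-sided ideal generated by the arrows (the paths of length one). -/
noncomputable def arrowIdeal : TwoSidedIdeal (PathAlgebra K V) :=
  pathIdeal K {p | p.path.length = 1}

/-- `I` is admissible: `J ^ N ⊆ I ⊆ J ^ 2` for some `N ≥ 2`, where `J` is the arrow ideal. -/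
def IsAdmissible (I : TwoSidedIdeal (PathAlgebra K V)) : Prop :=
  (∃ N : ℕ, 2 ≤ N ∧ (arrowIdeal K V).asIdeal ^ N ≤ I.asIdeal) ∧
    I.asIdeal ≤ (arrowIdeal K V).asIdeal ^ 2

/-- `I` is a monomial ideal: it is generated by a set of paths. -/
def IsMonomial (I : TwoSidedIdeal (PathAlgebra K V)) : Prop :=
  ∃ S : Set (QPath V), pathIdeal K S = I

/-- `T` is a minimal set (with respect to inclusion) of paths generating `I`. -/
def IsMinimalGeneratingSet (I : TwoSidedIdeal (PathAlgebra K V)) (T : Set (QPath V)) : Prop :=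
  Minimal (fun S : Set (QPath V) => pathIdeal K S = I) T

end

end PathAlgebra

/-! ### Quasi-hereditary rings -/

/-- A two-sided ideal `L` of `R` is heredity if `L * L = L`, `L * J(R) * L = 0`, and `L` is
projective as a left or as a right `R`-module. -/
def IsHeredityIdeal {R : Type*} [Ring R] (L : TwoSidedIdeal R) : Prop :=
  L.asIdeal * L.asIdeal = L.asIdeal ∧
    L.asIdeal * Ring.jacobson R * L.asIdeal = ⊥ ∧
    (Module.Projective R L ∨ Module.Projective Rᵐᵒᵖ L)

/-- `R` is quasi-hereditary: there is a finite chain `0 = L 0 ⊆ L 1 ⊆ ⋯ ⊆ L n = R` of two-sided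
ideals such that `L (i + 1) / L i` is a heredity ideal of `R / L i` for all `i < n`. -/
def IsQuasiHereditary (R : Type*) [Ring R] : Prop :=
  ∃ (n : ℕ) (L : ℕ → TwoSidedIdeal R), L 0 = ⊥ ∧ L n = ⊤ ∧
    ∀ i < n, L i ≤ L (i + 1) ∧
      IsHeredityIdeal ((L (i + 1)).map (Ideal.Quotient.mk (L i).asIdeal))

/-! ### Vertices and paths -/

namespace QPath

/-- `v` is properly internal to `t`: `t = p₁ v p₂` with `p₁`, `p₂` of length at least one. -/
def IsProperlyInternal {V : Type*} [Quiver V] (v : V) (t : QPath V) : Prop :=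
  ∃ (p₁ : Quiver.Path t.src v) (p₂ : Quiver.Path v t.tgt),
    1 ≤ p₁.length ∧ 1 ≤ p₂.length ∧ t.path = p₁.comp p₂

/-- The paths of `T` that pass through no vertex of `S` (not even as origin or end vertex), that
is, the paths of `T` in the quiver obtained by removing the vertices of `S`. -/
def avoiding {V : Type*} [Quiver V] (T : Set (QPath V)) (S : Set V) : Set (QPath V) :=
  {t ∈ T | ∀ v ∈ S, v ∉ t.path.vertices}

end QPath

/-!
# Quasi-hereditary monomial algebras

A path lies in the ideal generated by a set of paths exactly when it has a subpath in that set
(`PathAlgebra.mem_pathIdeal`). So the factor ring of a monomial algebra `K V / I` by the ideal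
generated by a set `S` of vertices has a basis of paths again: those that have no subpath in the
minimal generating set `T` and avoid `S`. All these rings are treated at once, as targets of a
surjection from the path algebra `K V` whose kernel is spanned by paths and contains all long paths
(`PathAlgebra.IsMonomialPresentation`).

In such a ring `R`, the condition on a vertex `v`, with idempotent `e`, that matters is that nonzero
paths `p` and `q` meeting at `v` have a nonzero concatenation
(`PathAlgebra.IsMonomialPresentation.ConcatenatesAt`). As `T` is minimal, it says that `v` is
properly internal to no path of `T` that avoids `S`.

* If the condition holds, there is no nonzero cycle at `v`, since its powers would be nonzero. Hence
  `e R e` is spanned by `e`, a nonzero path through `v` factors uniquely at `v`, and `R e R` is as a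
  left module the direct sum of copies of `R e` indexed by the nonzero paths starting at `v`. So
  `R e R` is a heredity ideal (`isHeredityIdeal_span_ofVertex`), and an ordering as in the theorem
  gives a heredity chain by adding one vertex at a time.
* Conversely, an idempotent ideal `L` is generated by the vertices it contains, because modulo these
  it lies in a nilpotent ideal (`eq_span_ofVertex`). If `L` is heredity, then `L J(R) L = 0` leaves
  no nonzero path of positive length between two vertices of `L`. A left projective `L` embeds into
  a sum of left ideals `R f` with `f` a vertex of `L`; a path `q` starting at a vertex `v` of `L`
  with idempotent `e` is mapped to a tuple of elements of `e R f`, that is, to scalar multiples of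
  `e`, and these are not annihilated by a nonzero path `p` ending at `v`. So `p q` is nonzero
  (`map_comp_ne_zero_of_isHeredityIdeal`). The case of a right projective `L` is symmetric. Hence
  every ideal of a heredity chain is generated by vertices, and sorting the vertices by the first
  ideal that contains them gives the ordering.
-/

/-! ### Factorizations of paths -/

/-- Two factorizations of a path are comparable: one of the two cutting points comes first, and
the factorizations differ by the path between the cutting points. -/
theorem Quiver.Path.exists_of_comp_eq_comp {V : Type*} [Quiver V] {a b b' c : V}
    (p : Path a b) (q : Path b c) (p' : Path a b') (q' : Path b' c)
    (h : p.comp q = p'.comp q') :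
    (∃ r : Path b b', q = r.comp q' ∧ p' = p.comp r) ∨
      ∃ r : Path b' b, q' = r.comp q ∧ p = p'.comp r := by
  induction q with
  | nil => exact Or.inr ⟨q', rfl, h⟩
  | cons q e ih =>
    cases q' with
    | nil => exact Or.inl ⟨q.cons e, rfl, h.symm⟩
    | cons q' e' =>
      simp only [Path.comp_cons] at h
      obtain rfl := Path.obj_eq_of_cons_eq_cons h
      have h1 := eq_of_heq (Path.heq_of_cons_eq_cons h)
      obtain rfl := eq_of_heq (Path.hom_heq_of_cons_eq_cons h)
      rcases ih q' h1 with ⟨r, rfl, rfl⟩ | ⟨r, rfl, rfl⟩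
      · exact Or.inl ⟨r, rfl, rfl⟩
      · exact Or.inr ⟨r, rfl, rfl⟩

theorem Quiver.Path.mem_vertices_comp {V : Type*} [Quiver V] {a b c w : V}
    (p : Path a b) (q : Path b c) :
    w ∈ (p.comp q).vertices ↔ w ∈ p.vertices ∨ w ∈ q.vertices := by
  induction q with
  | nil =>
    simp only [Path.comp_nil, Path.vertices_nil, List.mem_singleton]
    exact ⟨Or.inl, fun h => h.elim id fun h => h ▸ p.end_mem_vertices⟩
  | cons q e ih => simp only [Path.comp_cons, Path.mem_vertices_cons, ih, or_assoc]

namespace QPath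

variable {V : Type*} [Quiver V]

/-- `t` is a subpath of `p`: `p = x t y` for some paths `x` and `y`, possibly of length zero. -/
def IsSubpath (t p : QPath V) : Prop :=
  ∃ (x : Quiver.Path p.src t.src) (y : Quiver.Path t.tgt p.tgt), p.path = x.comp (t.path.comp y)

theorem IsSubpath.refl (t : QPath V) : IsSubpath t t :=
  ⟨Quiver.Path.nil, Quiver.Path.nil, by simp⟩

theorem IsSubpath.trans {s t p : QPath V} (h : IsSubpath s t) (h' : IsSubpath t p) :
    IsSubpath s p := by
  obtain ⟨x, y, h⟩ := h
  obtain ⟨x', y', h'⟩ := h'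
  exact ⟨x'.comp x, y.comp y', by rw [h', h]; simp only [Quiver.Path.comp_assoc]⟩

theorem isSubpath_comp_left {a b c : V} (p : Quiver.Path a b) (q : Quiver.Path b c) :
    IsSubpath ⟨a, b, p⟩ ⟨a, c, p.comp q⟩ :=
  ⟨Quiver.Path.nil, q, by simp⟩

theorem isSubpath_comp_right {a b c : V} (p : Quiver.Path a b) (q : Quiver.Path b c) :
    IsSubpath ⟨b, c, q⟩ ⟨a, c, p.comp q⟩ :=
  ⟨p, Quiver.Path.nil, by simp⟩

theorem IsSubpath.length_le {t p : QPath V} (h : IsSubpath t p) :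
    t.path.length ≤ p.path.length := by
  obtain ⟨x, y, h⟩ := h
  rw [h, Quiver.Path.length_comp, Quiver.Path.length_comp]
  omega

theorem IsSubpath.mem_vertices {t p : QPath V} (h : IsSubpath t p) {w : V}
    (hw : w ∈ t.path.vertices) : w ∈ p.path.vertices := by
  obtain ⟨x, y, h⟩ := h
  rw [h, Quiver.Path.mem_vertices_comp, Quiver.Path.mem_vertices_comp]
  exact Or.inr (Or.inl hw)

theorem vertex_isSubpath_iff {v : V} {p : QPath V} :
    IsSubpath (vertex v) p ↔ v ∈ p.path.vertices := by
  constructor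
  · intro h
    exact h.mem_vertices (by simp [vertex])
  · intro h
    obtain ⟨x, y, h⟩ := p.path.exists_eq_comp_of_mem_vertices h
    exact ⟨x, y, by simpa [vertex] using h⟩

theorem eq_vertex_of_length_eq_zero {p : QPath V} (h : p.path.length = 0) :
    p = vertex p.src := by
  obtain ⟨a, b, p⟩ := p
  obtain rfl := p.eq_of_length_zero h
  obtain rfl := p.eq_nil_of_length_zero h
  rfl

/-- A subpath of a concatenation at `v` that lies in neither of the two factors runs through `v`
properly. -/
theorem IsSubpath.of_comp {a v c : V} {p : Quiver.Path a v} {q : Quiver.Path v c} {t : QPath V}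
    (h : IsSubpath t ⟨a, c, p.comp q⟩) :
    IsSubpath t ⟨a, v, p⟩ ∨ IsSubpath t ⟨v, c, q⟩ ∨ IsProperlyInternal v t := by
  obtain ⟨ts, tt, t⟩ := t
  obtain ⟨x, y, h⟩ := h
  dsimp only at x y h ⊢
  rcases Quiver.Path.exists_of_comp_eq_comp _ _ _ _ h with ⟨r, hr, -⟩ | ⟨r, hr, hp⟩
  · exact Or.inr (Or.inl ⟨r, y, hr⟩)
  · rcases Quiver.Path.exists_of_comp_eq_comp _ _ _ _ hr with ⟨s, -, hs⟩ | ⟨s, hs, ht⟩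
    · exact Or.inl ⟨x, s, by rw [hp, hs]⟩
    · rcases Nat.eq_zero_or_pos r.length with h0 | h0
      · obtain rfl := r.eq_of_length_zero h0
        obtain rfl := r.eq_nil_of_length_zero h0
        refine Or.inr (Or.inl ⟨Quiver.Path.nil, y, ?_⟩)
        rw [hs, ht]
        simp
      · rcases Nat.eq_zero_or_pos s.length with h1 | h1
        · obtain rfl := s.eq_of_length_zero h1
          obtain rfl := s.eq_nil_of_length_zero h1
          refine Or.inl ⟨x, Quiver.Path.nil, ?_⟩
          rw [hp, ht]
          simp
        · exact Or.inr (Or.inr ⟨r, s, h0, h1, ht⟩)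

end QPath

/-! ### Elements and ideals of path algebras -/

namespace PathAlgebra

variable {K V : Type*} [Field K] [Quiver V]

theorem repr_ofPath (p : QPath V) : (basis K V).repr (ofPath K p) = Finsupp.single p 1 := by
  rw [← basis_apply, Module.Basis.repr_self]

theorem mem_span_ofPath {Z : Set (QPath V)} {x : PathAlgebra K V} :
    x ∈ Submodule.span K (ofPath K '' Z) ↔ ∀ p, (basis K V).repr x p ≠ 0 → p ∈ Z := by
  have := (basis K V).mem_span_image (m := x) (s := Z)
  simp only [funext basis_apply] at this
  rw [this]
  simp [Set.subset_def]

theorem ofPath_mul_ofPath_eq_zero_or (p q : QPath V) :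
    ofPath K p * ofPath K q = 0 ∨ ∃ (a b c : V) (r : Quiver.Path a b) (s : Quiver.Path b c),
      p = ⟨a, b, r⟩ ∧ q = ⟨b, c, s⟩ := by
  by_cases h : p.tgt = q.src
  · obtain ⟨a, b, r⟩ := p
    obtain ⟨b', c, s⟩ := q
    obtain rfl : b = b' := h
    exact Or.inr ⟨a, b, c, r, s, rfl, rfl⟩
  · exact Or.inl (ofPath_mul_ofPath_of_ne h)

variable (K) in
/-- The vertex `v` as an idempotent of the path algebra. -/
noncomputable abbrev ofVertex (v : V) : PathAlgebra K V := ofPath K (QPath.vertex v)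

theorem ofVertex_mul_self (v : V) : ofVertex K v * ofVertex K v = ofVertex K v :=
  ofPath_mul_ofPath_of_comp _ _

theorem ofVertex_mul_ofVertex_of_ne {v w : V} (h : v ≠ w) : ofVertex K v * ofVertex K w = 0 :=
  ofPath_mul_ofPath_of_ne h

theorem ofVertex_mul_ofPath {a b : V} (p : Quiver.Path a b) :
    ofVertex K a * ofPath K ⟨a, b, p⟩ = ofPath K ⟨a, b, p⟩ := by
  rw [ofVertex, QPath.vertex, ofPath_mul_ofPath_of_comp, Quiver.Path.nil_comp]

theorem ofPath_mul_ofVertex {a b : V} (p : Quiver.Path a b) :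
    ofPath K ⟨a, b, p⟩ * ofVertex K b = ofPath K ⟨a, b, p⟩ := by
  rw [ofVertex, QPath.vertex, ofPath_mul_ofPath_of_comp, Quiver.Path.comp_nil]

variable (K V) in
/-- The span of the paths of length at least `k`, that is, the `k`-th power of the arrow ideal. -/
noncomputable def lengthGE (k : ℕ) : Submodule K (PathAlgebra K V) :=
  Submodule.span K (ofPath K '' {p | k ≤ p.path.length})

theorem ofPath_mem_lengthGE {k : ℕ} {p : QPath V} (h : k ≤ p.path.length) :
    ofPath K p ∈ lengthGE K V k :=
  Submodule.subset_span ⟨p, h, rfl⟩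

theorem mem_lengthGE_zero (x : PathAlgebra K V) : x ∈ lengthGE K V 0 :=
  mem_span_ofPath.2 fun _ _ => Nat.zero_le _

section

variable [Fintype V]

theorem mul_mem_lengthGE {k l : ℕ} {x y : PathAlgebra K V} (hx : x ∈ lengthGE K V k)
    (hy : y ∈ lengthGE K V l) : x * y ∈ lengthGE K V (k + l) := by
  have h := Submodule.mul_mem_mul hx hy
  rw [lengthGE, lengthGE, Submodule.span_mul_span] at h
  refine Submodule.span_le.2 ?_ h
  rintro _ ⟨_, ⟨p, hp, rfl⟩, _, ⟨q, hq, rfl⟩, rfl⟩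
  rcases ofPath_mul_ofPath_eq_zero_or (K := K) p q with h | ⟨a, b, c, r, s, rfl, rfl⟩
  · simp [h]
  · simp only [ofPath_mul_ofPath_of_comp]
    refine ofPath_mem_lengthGE ?_
    simp only [Set.mem_ofPred_eq] at hp hq
    simp only [Quiver.Path.length_comp]
    omega

theorem pow_mem_lengthGE {x : PathAlgebra K V} (hx : x ∈ lengthGE K V 1) (k : ℕ) :
    x ^ k ∈ lengthGE K V k := by
  induction k with
  | zero => exact mem_lengthGE_zero _
  | succ k ih => rw [pow_succ]; exact mul_mem_lengthGE ih hx

/-- The path algebra is the sum of the span of the vertices and of the arrow ideal. -/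
theorem exists_sub_sum_mem_lengthGE_one (x : PathAlgebra K V) :
    ∃ c : V → K, x - ∑ v, c v • ofVertex K v ∈ lengthGE K V 1 := by
  classical
  induction x using PathAlgebra.induction with
  | zero => exact ⟨0, by simp⟩
  | add x y hx hy =>
    obtain ⟨c, hc⟩ := hx
    obtain ⟨d, hd⟩ := hy
    refine ⟨c + d, ?_⟩
    have := add_mem hc hd
    simp only [Pi.add_apply, add_smul, Finset.sum_add_distrib]
    rwa [add_sub_add_comm]
  | smul k x hx =>
    obtain ⟨c, hc⟩ := hx
    refine ⟨k • c, ?_⟩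
    have := Submodule.smul_mem _ k hc
    simpa only [smul_sub, Finset.smul_sum, Pi.smul_apply, smul_eq_mul, mul_smul] using this
  | path p =>
    rcases Nat.eq_zero_or_pos p.path.length with h | h
    · refine ⟨Pi.single p.src 1, ?_⟩
      rw [Finset.sum_eq_single p.src]
      · rw [Pi.single_eq_same, one_smul, ofVertex, ← QPath.eq_vertex_of_length_eq_zero h, sub_self]
        exact zero_mem _
      · intro v _ hv
        rw [Pi.single_eq_of_ne hv, zero_smul]
      · simp
    · exact ⟨0, by simpa using ofPath_mem_lengthGE h⟩

theorem ofVertex_mul_sum (c : V → K) (v : V) :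
    ofVertex K v * (∑ u, c u • ofVertex K u) = c v • ofVertex K v := by
  rw [Finset.mul_sum, Finset.sum_eq_single v]
  · rw [mul_smul_comm, ofVertex_mul_self]
  · intro u _ hu
    rw [mul_smul_comm, ofVertex_mul_ofVertex_of_ne hu.symm, smul_zero]
  · simp

/-- The corner of the path algebra between two vertices, modulo the paths of positive length. -/
theorem exists_ofVertex_mul_mul_ofVertex (v w : V) (x : PathAlgebra K V) :
    ∃ c : K, ∃ y ∈ lengthGE K V 1, ofVertex K v * x * ofVertex K w =
      c • (ofVertex K v * ofVertex K w) + ofVertex K v * y * ofVertex K w := by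
  obtain ⟨c, hc⟩ := exists_sub_sum_mem_lengthGE_one x
  refine ⟨c v, _, hc, ?_⟩
  rw [mul_sub, sub_mul, ofVertex_mul_sum, smul_mul_assoc]
  abel

theorem mem_pathIdeal {S : Set (QPath V)} {x : PathAlgebra K V} :
    x ∈ pathIdeal K S ↔ ∀ p, (basis K V).repr x p ≠ 0 → ∃ t ∈ S, QPath.IsSubpath t p := by
  constructor
  · let W : Submodule K (PathAlgebra K V) :=
      Submodule.span K (ofPath K '' {p | ∃ t ∈ S, QPath.IsSubpath t p})
    have hpath : ∀ {p : QPath V}, (∃ t ∈ S, QPath.IsSubpath t p) → ofPath K p ∈ W :=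
      fun h => Submodule.subset_span ⟨_, h, rfl⟩
    have hl : ∀ {x y}, y ∈ W → x * y ∈ W := by
      intro x y hy
      have h := Submodule.mul_mem_mul
        (show x ∈ Submodule.span K (ofPath K '' Set.univ) from mem_span_ofPath.2 (by simp)) hy
      rw [Submodule.span_mul_span] at h
      refine Submodule.span_le.2 ?_ h
      rintro _ ⟨_, ⟨p, -, rfl⟩, _, ⟨q, ⟨t, ht, htq⟩, rfl⟩, rfl⟩
      rcases ofPath_mul_ofPath_eq_zero_or (K := K) p q with h | ⟨a, b, c, r, s, rfl, rfl⟩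
      · simp [h]
      · simp only [ofPath_mul_ofPath_of_comp]
        exact hpath ⟨t, ht, htq.trans (QPath.isSubpath_comp_right _ _)⟩
    have hr : ∀ {x y}, x ∈ W → x * y ∈ W := by
      intro x y hx
      have h := Submodule.mul_mem_mul hx
        (show y ∈ Submodule.span K (ofPath K '' Set.univ) from mem_span_ofPath.2 (by simp))
      rw [Submodule.span_mul_span] at h
      refine Submodule.span_le.2 ?_ h
      rintro _ ⟨_, ⟨p, ⟨t, ht, htq⟩, rfl⟩, _, ⟨q, -, rfl⟩, rfl⟩
      rcases ofPath_mul_ofPath_eq_zero_or (K := K) p q with h | ⟨a, b, c, r, s, rfl, rfl⟩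
      · simp [h]
      · simp only [ofPath_mul_ofPath_of_comp]
        exact hpath ⟨t, ht, htq.trans (QPath.isSubpath_comp_left _ _)⟩
    have hle : pathIdeal K S ≤
        TwoSidedIdeal.mk' (W : Set _) W.zero_mem W.add_mem W.neg_mem hl hr := by
      refine TwoSidedIdeal.span_le.2 ?_
      rintro _ ⟨t, ht, rfl⟩
      simpa using hpath ⟨t, ht, QPath.IsSubpath.refl t⟩
    intro hx
    have := hle hx
    rw [TwoSidedIdeal.mem_mk'] at this
    exact mem_span_ofPath.1 this
  · intro h
    have hx : x ∈ Submodule.span K (ofPath K '' {p | ∃ t ∈ S, QPath.IsSubpath t p}) :=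
      mem_span_ofPath.2 h
    clear h
    induction hx using Submodule.span_induction with
    | zero => exact zero_mem _
    | mem _ hp =>
      obtain ⟨p, ⟨t, ht, y, z, hp⟩, rfl⟩ := hp
      obtain ⟨a, b, p⟩ := p
      dsimp only at y z hp
      rw [hp, ← ofPath_mul_ofPath_of_comp, ← ofPath_mul_ofPath_of_comp]
      exact TwoSidedIdeal.mul_mem_left _ _ _ (TwoSidedIdeal.mul_mem_right _ _ _
        (TwoSidedIdeal.subset_span ⟨t, ht, rfl⟩))
    | add x y _ _ hx hy => exact add_mem hx hy
    | smul k x _ hx =>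
      rw [← one_mul x, ← smul_mul_assoc]
      exact TwoSidedIdeal.mul_mem_left _ _ _ hx

theorem ofPath_mem_pathIdeal {S : Set (QPath V)} {p : QPath V} :
    ofPath K p ∈ pathIdeal K S ↔ ∃ t ∈ S, QPath.IsSubpath t p := by
  classical
  rw [mem_pathIdeal]
  constructor
  · intro h
    exact h p (by simp [repr_ofPath])
  · intro h q hq
    rw [repr_ofPath, Finsupp.single_apply] at hq
    obtain rfl : p = q := by by_contra h; simp [h] at hq
    exact h

end

end PathAlgebra

/-! ### Two-sided ideals of quotient rings -/

namespace TwoSidedIdeal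

variable {R S : Type*} [Ring R] [Ring S]

theorem map_span (f : R →+* S) (s : Set R) : (span s).map f = span (f '' s) := by
  refine le_antisymm (span_le.2 ?_) (span_mono (Set.image_mono subset_span))
  rintro _ ⟨x, hx, rfl⟩
  have : span s ≤ (span (f '' s)).comap f :=
    span_le.2 fun y hy => (mem_comap f).2 (subset_span ⟨y, hy, rfl⟩)
  exact (mem_comap f).1 (this hx)

theorem mk_mem_map_mk {L P : TwoSidedIdeal R} (hle : L ≤ P) {x : R} :
    Ideal.Quotient.mk L.asIdeal x ∈ P.map (Ideal.Quotient.mk L.asIdeal) ↔ x ∈ P := by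
  refine ⟨fun h => ?_, fun h => subset_span ⟨x, h, rfl⟩⟩
  have hle' : L.asIdeal ≤ P.asIdeal := fun y hy => mem_asIdeal.2 (hle (mem_asIdeal.1 hy))
  have : P.map (Ideal.Quotient.mk L.asIdeal) ≤ ker (Ideal.Quotient.factor hle') := by
    refine span_le.2 ?_
    rintro _ ⟨y, hy, rfl⟩
    simpa [mem_ker, Ideal.Quotient.eq_zero_iff_mem] using hy
  simpa [mem_ker, Ideal.Quotient.eq_zero_iff_mem] using this h

theorem eq_of_map_mk_eq {L P Q : TwoSidedIdeal R} (hP : L ≤ P) (hQ : L ≤ Q)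
    (h : P.map (Ideal.Quotient.mk L.asIdeal) = Q.map (Ideal.Quotient.mk L.asIdeal)) : P = Q := by
  ext x
  rw [← mk_mem_map_mk hP, h, mk_mem_map_mk hQ]

theorem induction_of_mul_self_eq {L : TwoSidedIdeal R} (h : L.asIdeal * L.asIdeal = L.asIdeal)
    {P : R → Prop} (hadd : ∀ x y, P x → P y → P (x + y))
    (hmul : ∀ a ∈ L, ∀ b ∈ L, P (a * b)) {x : R} (hx : x ∈ L) : P x := by
  rw [← mem_asIdeal, ← h] at hx
  exact Submodule.smul_induction_on hx
    (fun a ha b hb => hmul a (mem_asIdeal.1 ha) b (mem_asIdeal.1 hb)) hadd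

/-- Induction on the two-sided ideal generated by a set of elements. -/
theorem span_induction_mul {s : Set R} {P : R → Prop} (hzero : P 0)
    (hadd : ∀ x y, P x → P y → P (x + y)) (hmul : ∀ a, ∀ e ∈ s, ∀ b, P (a * e * b)) {x : R}
    (hx : x ∈ span s) : P x := by
  rw [mem_span_iff_mem_addSubgroup_closure] at hx
  induction hx using AddSubgroup.closure_induction'' with
  | zero => exact hzero
  | mem _ h =>
    obtain ⟨_, ⟨a, -, e, he, rfl⟩, b, -, rfl⟩ := h
    exact hmul a e he b
  | neg_mem _ h =>
    obtain ⟨_, ⟨a, -, e, he, rfl⟩, b, -, rfl⟩ := h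
    simpa using hmul (-a) e he b
  | add x y _ _ hx hy => exact hadd x y hx hy

end TwoSidedIdeal

/-! ### Projective modules and corners of rings -/

/-- Let `M` be a projective module generated by the subsets `e i • M`. If left multiplication by
`p` is injective on `a A e i` for all `i`, then it is injective on `a • M`: a section embeds `M`
into a sum of copies of the left ideals `A e i`. -/
theorem Module.Projective.eq_zero_of_smul_eq_zero {A M ι : Type*} [Ring A] [AddCommGroup M]
    [Module A M] [Module.Projective A M] (e : ι → A)
    (hgen : Submodule.span A {m : M | ∃ i m', m = e i • m'} = ⊤) {p a : A}
    (hp : ∀ i x, p * (a * x * e i) = 0 → a * x * e i = 0) {m : M} (ha : a • m = m)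
    (hm : p • m = 0) : m = 0 := by
  let g : (ι × M →₀ A) →ₗ[A] M := Finsupp.linearCombination A fun j => e j.1 • j.2
  have hg : LinearMap.range g = ⊤ := by
    rw [Finsupp.range_linearCombination, ← hgen]
    congr 1
    ext m
    simp [eq_comm]
  obtain ⟨s, hs⟩ := LinearMap.exists_rightInverse_of_surjective g hg
  have h1 : g (s m) = m := LinearMap.congr_fun hs m
  have h2 : ∀ j, s m j * e j.1 = 0 := by
    intro j
    have h3 : s m j = a * s m j := by
      conv_lhs => rw [← ha, map_smul, Finsupp.smul_apply, smul_eq_mul]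
    have h4 : p * s m j = 0 := by
      rw [← smul_eq_mul, ← Finsupp.smul_apply, ← map_smul, hm, map_zero, Finsupp.zero_apply]
    rw [h3]
    apply hp
    rw [← h3, ← mul_assoc, h4, zero_mul]
  rw [← h1, Finsupp.linearCombination_apply, Finsupp.sum]
  exact Finset.sum_eq_zero fun j _ => by rw [← mul_smul, h2, zero_smul]

theorem IsIdempotentElem.eq_zero_of_mem_jacobson {R : Type*} [Ring R] {e : R}
    (he : IsIdempotentElem e) (h : e ∈ Ring.jacobson R) : e = 0 := by
  rw [← Ideal.jacobson_bot, Ideal.mem_jacobson_iff] at h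
  obtain ⟨z, hz⟩ := h (-1)
  have h1 : z * (1 - e) = 1 := by
    rw [Ideal.mem_bot] at hz
    rw [← sub_eq_zero, ← hz]
    noncomm_ring
  calc e = z * (1 - e) * e := by rw [h1, one_mul]
    _ = 0 := by rw [mul_assoc, sub_mul, one_mul, he.eq, sub_self, mul_zero]

/-! ### Monomial presentations of rings -/

namespace PathAlgebra

variable {K V R : Type*} [Field K] [Quiver V] [Fintype V] [Ring R]

/-- A surjective homomorphism from a path algebra whose kernel is spanned by paths and contains
all sufficiently long paths. Vertices are allowed in the kernel, so that the factor rings of a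
monomial algebra by ideals generated by vertices are covered without changing the quiver. -/
structure IsMonomialPresentation (π : PathAlgebra K V →+* R) : Prop where
  surjective : Function.Surjective π
  map_ofPath_eq_zero : ∀ x, π x = 0 → ∀ p, (basis K V).repr x p ≠ 0 → π (ofPath K p) = 0
  exists_length : ∃ N : ℕ, ∀ p : QPath V, N ≤ p.path.length → π (ofPath K p) = 0

namespace IsMonomialPresentation

variable {π : PathAlgebra K V →+* R}

theorem map_smul_eq_zero {c : K} {x : PathAlgebra K V} (h : π x = 0) : π (c • x) = 0 := by
  rw [← one_mul x, ← smul_mul_assoc, map_mul, h, mul_zero]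

theorem map_eq_zero_of_mem_span {Z : Set (QPath V)} (h : ∀ p ∈ Z, π (ofPath K p) = 0)
    {x : PathAlgebra K V} (hx : x ∈ Submodule.span K (ofPath K '' Z)) : π x = 0 := by
  induction hx using Submodule.span_induction with
  | zero => exact map_zero π
  | mem _ hp => obtain ⟨p, hp, rfl⟩ := hp; exact h p hp
  | add x y _ _ hx hy => rw [map_add, hx, hy, add_zero]
  | smul k x _ hx => exact map_smul_eq_zero hx

theorem isNilpotent_map (hπ : IsMonomialPresentation π) {x : PathAlgebra K V}
    (hx : x ∈ lengthGE K V 1) : IsNilpotent (π x) := by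
  obtain ⟨N, hN⟩ := hπ.exists_length
  exact ⟨N, by rw [← map_pow]; exact map_eq_zero_of_mem_span hN (pow_mem_lengthGE hx N)⟩

theorem map_mem_jacobson (hπ : IsMonomialPresentation π) {x : PathAlgebra K V}
    (hx : x ∈ lengthGE K V 1) : π x ∈ Ring.jacobson R := by
  rw [← Ideal.jacobson_bot, Ideal.mem_jacobson_iff]
  intro y
  obtain ⟨y, rfl⟩ := hπ.surjective y
  have h : IsNilpotent (π y * π x) := by
    rw [← map_mul]
    exact hπ.isNilpotent_map (by simpa using mul_mem_lengthGE (mem_lengthGE_zero y) hx)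
  obtain ⟨u, hu⟩ := h.isUnit_one_add
  refine ⟨↑u⁻¹, ?_⟩
  have h1 : (↑u⁻¹ : R) * (1 + π y * π x) = 1 := by rw [← hu, Units.inv_mul]
  rw [Ideal.mem_bot, ← sub_eq_zero.2 h1]
  noncomm_ring

theorem eq_zero_of_map_smul_ofPath (hπ : IsMonomialPresentation π) {c : K} {p : QPath V}
    (hp : π (ofPath K p) ≠ 0) (h : π (c • ofPath K p) = 0) : c = 0 := by
  by_contra hc
  exact hp (hπ.map_ofPath_eq_zero _ h p (by simpa [repr_ofPath] using hc))

/-! ### Heredity ideals are generated by vertices -/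

/-- If an ideal contains `x` and the vertex `v` has a nonzero coefficient in `x`, then the ideal
contains `v`, because `v x v` is a unit of the local ring `v R v`. -/
theorem ofVertex_mem_of_coeff_ne_zero (hπ : IsMonomialPresentation π) (L : TwoSidedIdeal R)
    {x y : PathAlgebra K V} {c : K} {v : V} (hx : π x ∈ L) (hy : y ∈ lengthGE K V 1) (hc : c ≠ 0)
    (h : ofVertex K v * x * ofVertex K v = c • ofVertex K v + ofVertex K v * y * ofVertex K v) :
    π (ofVertex K v) ∈ L := by
  have hz : ofVertex K v * y * ofVertex K v ∈ lengthGE K V 1 := by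
    have := mul_mem_lengthGE
      (mul_mem_lengthGE (mem_lengthGE_zero (ofVertex K v)) hy) (mem_lengthGE_zero (ofVertex K v))
    simpa using this
  have hcu : IsUnit (π (c • 1)) := by
    rw [← Algebra.algebraMap_eq_smul_one]
    exact ((IsUnit.mk0 c hc).map (algebraMap K (PathAlgebra K V))).map π
  have hcomm : Commute (π (ofVertex K v * y * ofVertex K v)) (π (c • 1)) :=
    Commute.map (by simp [Commute, SemiconjBy]) π
  obtain ⟨u, hu⟩ := (hπ.isNilpotent_map hz).isUnit_add_left_of_commute hcu hcomm
  have h1 : π (ofVertex K v) * u = π (ofVertex K v * x * ofVertex K v) := by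
    rw [hu, ← map_add, ← map_mul, h, mul_add, mul_smul_comm, mul_one, ← mul_assoc, ← mul_assoc,
      ofVertex_mul_self]
  have h2 : π (ofVertex K v) = π (ofVertex K v * x * ofVertex K v) * ↑u⁻¹ := by
    rw [← h1, Units.mul_inv_cancel_right]
  rw [h2, map_mul, map_mul]
  exact L.mul_mem_right _ _ (L.mul_mem_right _ _ (L.mul_mem_left _ _ hx))

/-- An idempotent ideal is generated by the vertices that it contains: modulo these, it lies in
the nilpotent ideal generated by the arrows. -/
theorem eq_span_ofVertex (hπ : IsMonomialPresentation π) {L : TwoSidedIdeal R}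
    (hL : L.asIdeal * L.asIdeal = L.asIdeal) :
    L = TwoSidedIdeal.span ((fun v => π (ofVertex K v)) '' {v | π (ofVertex K v) ∈ L}) := by
  set L' := TwoSidedIdeal.span ((fun v => π (ofVertex K v)) '' {v | π (ofVertex K v) ∈ L}) with hL'
  have hle : L' ≤ L := by
    refine TwoSidedIdeal.span_le.2 ?_
    rintro _ ⟨v, hv, rfl⟩
    exact hv
  have h1 : ∀ x ∈ L, ∃ l ∈ L', ∃ j ∈ lengthGE K V 1, x = l + π j := by
    intro x hx
    obtain ⟨x, rfl⟩ := hπ.surjective x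
    obtain ⟨c, hc⟩ := exists_sub_sum_mem_lengthGE_one x
    refine ⟨π (∑ v, c v • ofVertex K v), ?_, _, hc, by simp⟩
    rw [map_sum]
    refine sum_mem fun v _ => ?_
    by_cases hcv : c v = 0
    · rw [hcv, zero_smul, map_zero]
      exact zero_mem _
    · have hv : π (ofVertex K v) ∈ L := by
        refine hπ.ofVertex_mem_of_coeff_ne_zero L hx hc hcv ?_
        rw [mul_sub, sub_mul, ofVertex_mul_sum, smul_mul_assoc, ofVertex_mul_self]
        abel
      rw [← one_mul (ofVertex K v), ← smul_mul_assoc, map_mul]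
      exact L'.mul_mem_left _ _ (TwoSidedIdeal.subset_span ⟨v, hv, rfl⟩)
  have hk : ∀ k, ∀ x ∈ L, ∃ l ∈ L', ∃ j ∈ lengthGE K V k, x = l + π j := by
    intro k
    induction k with
    | zero =>
      intro x _
      obtain ⟨x, rfl⟩ := hπ.surjective x
      exact ⟨0, zero_mem _, x, mem_lengthGE_zero x, by simp⟩
    | succ k ih =>
      intro x hx
      refine TwoSidedIdeal.induction_of_mul_self_eq hL
        (P := fun x => ∃ l ∈ L', ∃ j ∈ lengthGE K V (k + 1), x = l + π j) ?_ ?_ hx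
      · rintro x y ⟨l, hl, j, hj, rfl⟩ ⟨l', hl', j', hj', rfl⟩
        exact ⟨l + l', add_mem hl hl', j + j', add_mem hj hj', by rw [map_add]; abel⟩
      · intro a ha b hb
        obtain ⟨l, hl, j, hj, rfl⟩ := ih a ha
        obtain ⟨l', hl', j', hj', rfl⟩ := h1 b hb
        refine ⟨l * (l' + π j') + π j * l', add_mem (L'.mul_mem_right _ _ hl)
          (L'.mul_mem_left _ _ hl'), j * j', mul_mem_lengthGE hj hj', ?_⟩
        rw [map_mul]
        noncomm_ring
  refine le_antisymm (fun x hx => ?_) hle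
  obtain ⟨N, hN⟩ := hπ.exists_length
  obtain ⟨l, hl, j, hj, rfl⟩ := hk N x hx
  rwa [map_eq_zero_of_mem_span hN hj, add_zero]

/-! ### Concatenation at the vertices of a heredity ideal -/

/-- If a heredity ideal contains the vertex `v`, then the concatenation at `v` of two nonzero
paths is nonzero. -/
theorem map_comp_ne_zero_of_isHeredityIdeal (hπ : IsMonomialPresentation π) {L : TwoSidedIdeal R}
    (hL : IsHeredityIdeal L) {a v c : V} (hv : π (ofVertex K v) ∈ L) (p : Quiver.Path a v)
    (q : Quiver.Path v c) (hp : π (ofPath K ⟨a, v, p⟩) ≠ 0) (hq : π (ofPath K ⟨v, c, q⟩) ≠ 0) :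
    π (ofPath K ⟨a, c, p.comp q⟩) ≠ 0 := by
  obtain ⟨hLL, hLJL, hproj⟩ := hL
  have hspan := hπ.eq_span_ofVertex hLL
  let ι := {w : V // π (ofVertex K w) ∈ L}
  let e : ι → R := fun w => π (ofVertex K w.1)
  -- the corner of `R` between two vertices of `L` is at most one-dimensional
  have hcorner : ∀ (u w : ι) (x : R),
      ∃ k : K, e u * x * e w = π (k • (ofVertex K u.1 * ofVertex K w.1)) := by
    intro u w x
    obtain ⟨x, rfl⟩ := hπ.surjective x
    obtain ⟨k, y, hy, h⟩ := exists_ofVertex_mul_mul_ofVertex u.1 w.1 x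
    refine ⟨k, ?_⟩
    have h0 : e u * π y * e w ∈ L.asIdeal * Ring.jacobson R * L.asIdeal :=
      Ideal.mul_mem_mul (Ideal.mul_mem_mul (TwoSidedIdeal.mem_asIdeal.2 u.2)
        (hπ.map_mem_jacobson hy)) (TwoSidedIdeal.mem_asIdeal.2 w.2)
    rw [hLJL, Ideal.mem_bot] at h0
    have h1 := congrArg π h
    rw [map_add, map_mul, map_mul, map_mul π (ofVertex K u.1 * y), map_mul π (ofVertex K u.1) y]
      at h1
    rw [h0, add_zero] at h1
    exact h1
  have hpe : π (ofPath K ⟨a, v, p⟩) * e ⟨v, hv⟩ = π (ofPath K ⟨a, v, p⟩) := by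
    rw [← map_mul, ofPath_mul_ofVertex]
  have heq : e ⟨v, hv⟩ * π (ofPath K ⟨v, c, q⟩) = π (ofPath K ⟨v, c, q⟩) := by
    rw [← map_mul, ofVertex_mul_ofPath]
  have hee : ∀ w, e w * e w = e w := fun w => by rw [← map_mul, ofVertex_mul_self]
  have hpL : π (ofPath K ⟨a, v, p⟩) ∈ L := hpe ▸ L.mul_mem_left _ _ hv
  have hqL : π (ofPath K ⟨v, c, q⟩) ∈ L := heq ▸ L.mul_mem_right _ _ hv
  intro h0
  rw [← ofPath_mul_ofPath_of_comp, map_mul] at h0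
  rcases hproj with hproj | hproj
  · refine hq (congrArg Subtype.val (Module.Projective.eq_zero_of_smul_eq_zero (A := R) (M := L) e
      ?_ (p := π (ofPath K ⟨a, v, p⟩)) (a := e ⟨v, hv⟩) ?_ (m := ⟨_, hqL⟩) (Subtype.ext heq)
      (Subtype.ext h0)))
    · refine eq_top_iff.2 ?_
      rintro ⟨x, hx⟩ -
      have : ∃ hx : x ∈ L, (⟨x, hx⟩ : L) ∈
          Submodule.span R {m : L | ∃ i m', m = e i • m'} := by
        rw [hspan] at hx
        refine TwoSidedIdeal.span_induction_mul (P := fun x => ∃ hx : x ∈ L, (⟨x, hx⟩ : L) ∈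
          Submodule.span R {m : L | ∃ i m', m = e i • m'}) ⟨zero_mem _, zero_mem _⟩ ?_ ?_ hx
        · rintro x y ⟨hx, hx'⟩ ⟨hy, hy'⟩
          exact ⟨add_mem hx hy, add_mem hx' hy'⟩
        · rintro r _ ⟨w, hw, rfl⟩ s
          have hws : e ⟨w, hw⟩ * s ∈ L := L.mul_mem_right _ _ hw
          refine ⟨L.mul_mem_right _ _ (L.mul_mem_left _ _ hw), ?_⟩
          have := Submodule.smul_mem (Submodule.span R {m : L | ∃ i m', m = e i • m'}) r
            (Submodule.subset_span ⟨⟨w, hw⟩, ⟨_, hws⟩, rfl⟩)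
          convert this using 1
          refine Subtype.ext ?_
          change r * e ⟨w, hw⟩ * s = r * (e ⟨w, hw⟩ * (e ⟨w, hw⟩ * s))
          rw [← mul_assoc (e _), hee, mul_assoc]
      exact this.2
    · intro w x hx
      obtain ⟨k, hk⟩ := hcorner ⟨v, hv⟩ w x
      rw [hk] at hx ⊢
      by_cases hvw : v = w.1
      · rw [← hvw, ofVertex_mul_self] at hx ⊢
        rw [← map_mul, mul_smul_comm, ofPath_mul_ofVertex] at hx
        rw [hπ.eq_zero_of_map_smul_ofPath hp hx, zero_smul, map_zero]
      · rw [ofVertex_mul_ofVertex_of_ne hvw, smul_zero, map_zero]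
  · refine hp (congrArg Subtype.val (Module.Projective.eq_zero_of_smul_eq_zero (A := Rᵐᵒᵖ) (M := L)
      (fun w => MulOpposite.op (e w)) ?_ (p := MulOpposite.op (π (ofPath K ⟨v, c, q⟩)))
      (a := MulOpposite.op (e ⟨v, hv⟩)) ?_ (m := ⟨_, hpL⟩) (Subtype.ext hpe) (Subtype.ext h0)))
    · refine eq_top_iff.2 ?_
      rintro ⟨x, hx⟩ -
      have : ∃ hx : x ∈ L, (⟨x, hx⟩ : L) ∈
          Submodule.span Rᵐᵒᵖ {m : L | ∃ i m', m = MulOpposite.op (e i) • m'} := by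
        rw [hspan] at hx
        refine TwoSidedIdeal.span_induction_mul (P := fun x => ∃ hx : x ∈ L, (⟨x, hx⟩ : L) ∈
          Submodule.span Rᵐᵒᵖ {m : L | ∃ i m', m = MulOpposite.op (e i) • m'})
          ⟨zero_mem _, zero_mem _⟩ ?_ ?_ hx
        · rintro x y ⟨hx, hx'⟩ ⟨hy, hy'⟩
          exact ⟨add_mem hx hy, add_mem hx' hy'⟩
        · rintro r _ ⟨w, hw, rfl⟩ s
          have hrw : r * e ⟨w, hw⟩ ∈ L := L.mul_mem_left _ _ hw
          refine ⟨L.mul_mem_right _ _ (L.mul_mem_left _ _ hw), ?_⟩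
          have := Submodule.smul_mem
            (Submodule.span Rᵐᵒᵖ {m : L | ∃ i m', m = MulOpposite.op (e i) • m'})
            (MulOpposite.op s) (Submodule.subset_span ⟨⟨w, hw⟩, ⟨_, hrw⟩, rfl⟩)
          convert this using 1
          refine Subtype.ext ?_
          change r * e ⟨w, hw⟩ * s = r * e ⟨w, hw⟩ * e ⟨w, hw⟩ * s
          rw [mul_assoc r (e _) (e _), hee]
      exact this.2
    · intro w x hx
      obtain ⟨k, hk⟩ := hcorner w ⟨v, hv⟩ x.unop
      have hk' : MulOpposite.op (e ⟨v, hv⟩) * x * MulOpposite.op (e w) =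
          MulOpposite.op (π (k • (ofVertex K w.1 * ofVertex K v))) := by
        rw [← hk]
        simp [mul_assoc]
      rw [hk'] at hx ⊢
      by_cases hvw : w.1 = v
      · rw [hvw, ofVertex_mul_self] at hx ⊢
        rw [← MulOpposite.op_mul, ← map_mul, smul_mul_assoc, ofVertex_mul_ofPath,
          MulOpposite.op_eq_zero_iff] at hx
        rw [hπ.eq_zero_of_map_smul_ofPath hq hx, zero_smul, map_zero, MulOpposite.op_zero]
      · rw [ofVertex_mul_ofVertex_of_ne hvw, smul_zero, map_zero, MulOpposite.op_zero]

end IsMonomialPresentation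

end PathAlgebra

namespace PathAlgebra

namespace IsMonomialPresentation

variable {K V R : Type*} [Field K] [Quiver V] [Fintype V] [Ring R] {π : PathAlgebra K V →+* R}

/-! ### Heredity ideals generated by one vertex -/

variable (π) in
/-- Nonzero paths that meet at the vertex `v` have a nonzero concatenation. -/
def ConcatenatesAt (v : V) : Prop :=
  ∀ ⦃a c : V⦄ (p : Quiver.Path a v) (q : Quiver.Path v c), π (ofPath K ⟨a, v, p⟩) ≠ 0 →
    π (ofPath K ⟨v, c, q⟩) ≠ 0 → π (ofPath K ⟨a, c, p.comp q⟩) ≠ 0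

/-- A nonzero cycle at `v` would have nonzero powers of arbitrary length. -/
theorem eq_nil_of_concatenatesAt (hπ : IsMonomialPresentation π) {v : V}
    (hv : ConcatenatesAt π v) (r : Quiver.Path v v) (hr : π (ofPath K ⟨v, v, r⟩) ≠ 0) :
    r = Quiver.Path.nil := by
  by_contra hne
  have hlen : 1 ≤ r.length := by
    by_contra h
    exact hne (r.eq_nil_of_length_zero (by omega))
  have hpow : ∀ k, ∃ s : Quiver.Path v v, k ≤ s.length ∧ π (ofPath K ⟨v, v, s⟩) ≠ 0 := by
    intro k
    induction k with
    | zero => exact ⟨r, Nat.zero_le _, hr⟩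
    | succ k ih =>
      obtain ⟨s, hs, hs'⟩ := ih
      exact ⟨s.comp r, by rw [Quiver.Path.length_comp]; omega, hv s r hs' hr⟩
  obtain ⟨N, hN⟩ := hπ.exists_length
  obtain ⟨s, hs, hs'⟩ := hpow N
  exact hs' (hN ⟨v, v, s⟩ hs)

/-- A nonzero path through `v` has only one factorization at `v`, as there are no cycles. -/
theorem comp_inj_of_concatenatesAt (hπ : IsMonomialPresentation π) {v : V}
    (hv : ConcatenatesAt π v) {a c : V} {p p' : Quiver.Path a v} {q q' : Quiver.Path v c}
    (hq : π (ofPath K ⟨v, c, q⟩) ≠ 0) (hq' : π (ofPath K ⟨v, c, q'⟩) ≠ 0)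
    (h : p.comp q = p'.comp q') : p = p' ∧ q = q' := by
  rcases Quiver.Path.exists_of_comp_eq_comp _ _ _ _ h with ⟨r, rfl, rfl⟩ | ⟨r, rfl, rfl⟩
  · have hr : π (ofPath K ⟨v, v, r⟩) ≠ 0 := fun h0 => hq (by
      rw [← ofPath_mul_ofPath_of_comp, map_mul, h0, zero_mul])
    rw [hπ.eq_nil_of_concatenatesAt hv r hr]
    simp
  · have hr : π (ofPath K ⟨v, v, r⟩) ≠ 0 := fun h0 => hq' (by
      rw [← ofPath_mul_ofPath_of_comp, map_mul, h0, zero_mul])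
    rw [hπ.eq_nil_of_concatenatesAt hv r hr]
    simp

/-- If nonzero paths that meet at `v` have nonzero concatenations, then the corner at `v` is at most
one-dimensional over `K`, as there are no nonzero cycles. -/
theorem ofVertex_mul_mul_ofVertex_eq (hπ : IsMonomialPresentation π) {v : V}
    (hv : ConcatenatesAt π v) (x : PathAlgebra K V) :
    ∃ c : K, π (ofVertex K v * x * ofVertex K v) = π (c • ofVertex K v) := by
  obtain ⟨c, y, hy, h⟩ := exists_ofVertex_mul_mul_ofVertex v v x
  refine ⟨c, ?_⟩
  have hy0 : π (ofVertex K v * y * ofVertex K v) = 0 := by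
    rw [lengthGE] at hy
    clear h
    induction hy using Submodule.span_induction with
    | zero => simp
    | add x y _ _ hx hy => rw [mul_add, add_mul, map_add, hx, hy, add_zero]
    | smul k x _ hx => rw [mul_smul_comm, smul_mul_assoc]; exact map_smul_eq_zero hx
    | mem _ hp =>
      obtain ⟨⟨a, b, p⟩, hp, rfl⟩ := hp
      by_cases ha : v = a
      · by_cases hb : b = v
        · subst ha hb
          rw [ofVertex_mul_ofPath, ofPath_mul_ofVertex]
          by_contra h0
          rw [hπ.eq_nil_of_concatenatesAt hv p h0] at hp
          simp at hp
        · rw [mul_assoc, ofVertex, ofPath_mul_ofPath_of_ne (p := ⟨a, b, p⟩) hb, mul_zero, map_zero]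
      · rw [ofVertex, ofPath_mul_ofPath_of_ne (q := ⟨a, b, p⟩) ha, zero_mul, map_zero]
  rw [h, map_add, hy0, add_zero, ofVertex_mul_self]

/-- The elements of the left ideal generated by `v` are represented by combinations of nonzero paths
that end at `v`. -/
theorem exists_normal_form (v : V) (x : PathAlgebra K V) :
    ∃ y ∈ Submodule.span K (ofPath K '' {p | p.tgt = v ∧ π (ofPath K p) ≠ 0}),
      π y = π (x * ofVertex K v) := by
  induction x using PathAlgebra.induction with
  | zero => exact ⟨0, zero_mem _, by simp⟩
  | add x x' hx hx' =>
    obtain ⟨y, hy, h⟩ := hx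
    obtain ⟨y', hy', h'⟩ := hx'
    exact ⟨y + y', add_mem hy hy', by rw [map_add, h, h', add_mul, map_add]⟩
  | smul k x hx =>
    obtain ⟨y, hy, h⟩ := hx
    refine ⟨k • y, Submodule.smul_mem _ _ hy, ?_⟩
    rw [← sub_eq_zero, ← map_sub, smul_mul_assoc, ← smul_sub]
    exact map_smul_eq_zero (by rw [map_sub, h, sub_self])
  | path p =>
    obtain ⟨a, b, p⟩ := p
    by_cases hb : b = v
    · subst hb
      rw [ofPath_mul_ofVertex]
      by_cases h0 : π (ofPath K ⟨a, b, p⟩) = 0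
      · exact ⟨0, zero_mem _, by rw [h0, map_zero]⟩
      · exact ⟨_, Submodule.subset_span ⟨_, ⟨rfl, h0⟩, rfl⟩, rfl⟩
    · exact ⟨0, zero_mem _, by
        rw [ofVertex, ofPath_mul_ofPath_of_ne (p := ⟨a, b, p⟩) hb]⟩

open Classical in
/-- Coefficients of products of normal forms ending at `v` with nonzero paths starting at `v`. -/
theorem repr_mul_ofPath (hπ : IsMonomialPresentation π) {v : V} (hv : ConcatenatesAt π v)
    {y : PathAlgebra K V}
    (hy : y ∈ Submodule.span K (ofPath K '' {p | p.tgt = v ∧ π (ofPath K p) ≠ 0}))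
    (q q' : {q : Σ c, Quiver.Path v c // π (ofPath K ⟨v, q.1, q.2⟩) ≠ 0}) {a : V}
    (p : Quiver.Path a v) :
    (basis K V).repr (y * ofPath K ⟨v, q.1.1, q.1.2⟩) ⟨a, q'.1.1, p.comp q'.1.2⟩ =
      if q = q' then (basis K V).repr y ⟨a, v, p⟩ else 0 := by
  induction hy using Submodule.span_induction with
  | zero => simp
  | add x y _ _ hx hy =>
    rw [add_mul, map_add, Finsupp.add_apply, hx, hy, map_add, Finsupp.add_apply]
    split_ifs <;> simp
  | smul k x _ hx =>
    rw [smul_mul_assoc, map_smul, Finsupp.smul_apply, hx, map_smul, Finsupp.smul_apply]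
    split_ifs <;> simp
  | mem _ hp =>
    obtain ⟨⟨a', b, p'⟩, ⟨hb, -⟩, rfl⟩ := hp
    dsimp only at hb
    subst hb
    obtain ⟨⟨c, q⟩, hq⟩ := q
    obtain ⟨⟨c', q'⟩, hq'⟩ := q'
    dsimp only at hq hq' ⊢
    rw [ofPath_mul_ofPath_of_comp, repr_ofPath, repr_ofPath, Finsupp.single_apply,
      Finsupp.single_apply, ← ite_and]
    refine if_congr ?_ rfl rfl
    constructor
    · intro h
      simp only [QPath.mk.injEq] at h
      obtain ⟨rfl, rfl, h⟩ := h
      obtain ⟨rfl, rfl⟩ := hπ.comp_inj_of_concatenatesAt hv hq hq' (eq_of_heq h)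
      exact ⟨rfl, rfl⟩
    · rintro ⟨h, h'⟩
      simp only [Subtype.mk.injEq, Sigma.mk.injEq] at h
      simp only [QPath.mk.injEq] at h'
      obtain ⟨rfl, h⟩ := h
      obtain ⟨rfl, -, h'⟩ := h'
      rw [eq_of_heq h, eq_of_heq h']

/-- If nonzero paths that meet at `v` have nonzero concatenations, then the ideal generated by
the idempotent `e` of `v` is, as a left module, the direct sum of copies of `R e`, one for each
nonzero path that starts at `v`. -/
theorem projective_span_ofVertex (hπ : IsMonomialPresentation π) {v : V}
    (hv : ConcatenatesAt π v) :
    Module.Projective R (TwoSidedIdeal.span {π (ofVertex K v)}) := by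
  classical
  set e := π (ofVertex K v) with he
  have hee : e * e = e := by rw [he, ← map_mul, ofVertex_mul_self]
  set L := TwoSidedIdeal.span {e} with hL
  have heL : e ∈ L := TwoSidedIdeal.subset_span rfl
  let P : Submodule R R := LinearMap.range (LinearMap.toSpanSingleton R R e)
  have hPe : ∀ x : P, (x : R) * e = x := by
    rintro ⟨_, r, rfl⟩
    simp [mul_assoc, hee]
  have hP : Module.Projective R P :=
    Module.Projective.of_split P.subtype (LinearMap.toSpanSingleton R R e).rangeRestrict
      (LinearMap.ext fun x => Subtype.ext (hPe x))
  let B := {q : Σ c, Quiver.Path v c // π (ofPath K ⟨v, q.1, q.2⟩) ≠ 0}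
  have hPL : ∀ (x : P) (r : R), (x : R) * r ∈ L := fun x r => by
    rw [← hPe x]
    exact L.mul_mem_right _ _ (L.mul_mem_left _ _ heL)
  let φ : B → P →ₗ[R] L := fun q =>
    { toFun := fun x => ⟨x * π (ofPath K ⟨v, q.1.1, q.1.2⟩), hPL x _⟩
      map_add' := fun x y => Subtype.ext (add_mul _ _ _)
      map_smul' := fun r x => Subtype.ext (mul_assoc _ _ _) }
  let Φ : (Π₀ _ : B, P) →ₗ[R] L := DFinsupp.lsum ℕ φ
  have hΦ : ∀ f, (Φ f : R) = ∑ q ∈ f.support, (f q : R) * π (ofPath K ⟨v, q.1.1, q.1.2⟩) := by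
    intro f
    simp only [Φ, DFinsupp.lsum_apply_apply, DFinsupp.sumAddHom_apply, DFinsupp.sum]
    exact map_sum (TwoSidedIdeal.coeAddMonoidHom L) _ _
  refine Module.Projective.of_equiv' (LinearEquiv.ofBijective Φ ⟨?_, ?_⟩)
  · refine (injective_iff_map_eq_zero Φ).2 fun f hf => ?_
    have hy : ∀ q, ∃ y ∈ Submodule.span K (ofPath K '' {p | p.tgt = v ∧ π (ofPath K p) ≠ 0}),
        π y = f q := by
      intro q
      obtain ⟨x, hx⟩ := hπ.surjective (f q)
      obtain ⟨y, hy, hyx⟩ := exists_normal_form (π := π) v x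
      exact ⟨y, hy, by rw [hyx, map_mul, hx, hPe]⟩
    choose y hy hyf using hy
    have h0 : π (∑ q ∈ f.support, y q * ofPath K ⟨v, q.1.1, q.1.2⟩) = 0 := by
      rw [map_sum]
      simp only [map_mul, hyf]
      rw [← hΦ, hf]
      rfl
    refine DFinsupp.ext fun q => ?_
    by_cases hq : q ∈ f.support
    · have hyq : y q = 0 := by
        refine (basis K V).repr.map_eq_zero_iff.1 (Finsupp.ext fun p => ?_)
        by_contra hp
        obtain ⟨hpv, hp0⟩ := mem_span_ofPath.1 (hy q) p hp
        obtain ⟨a, b, p⟩ := p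
        dsimp only at hpv
        subst hpv
        refine hv p q.1.2 hp0 q.2 (hπ.map_ofPath_eq_zero _ h0 ⟨a, q.1.1, p.comp q.1.2⟩ ?_)
        rw [map_sum, Finsupp.finsetSum_apply,
          Finset.sum_congr rfl fun q' _ => hπ.repr_mul_ofPath hv (hy q') q' q p]
        rw [Finset.sum_ite_eq' f.support q, if_pos hq]
        exact hp
      refine Subtype.ext ?_
      rw [← hyf, hyq, map_zero]
      rfl
    · rw [DFinsupp.notMem_support_iff.1 hq]
      rfl
  · have hmem : ∀ z : PathAlgebra K V, ∃ f, (Φ f : R) = e * π z := by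
      intro z
      induction z using PathAlgebra.induction with
      | zero => exact ⟨0, by simp⟩
      | add x y hx hy =>
        obtain ⟨f, hf⟩ := hx
        obtain ⟨g, hg⟩ := hy
        exact ⟨f + g, by rw [map_add, map_add, mul_add, ← hf, ← hg]; rfl⟩
      | smul k x hx =>
        obtain ⟨f, hf⟩ := hx
        refine ⟨π (k • 1) • f, ?_⟩
        rw [map_smul]
        change π (k • 1) * (Φ f : R) = _
        rw [hf, he, ← map_mul, ← map_mul, ← map_mul, smul_mul_assoc, one_mul, mul_smul_comm]
      | path p =>
        obtain ⟨a, b, p⟩ := p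
        by_cases ha : v = a
        · subst ha
          by_cases h0 : π (ofPath K ⟨v, b, p⟩) = 0
          · exact ⟨0, by rw [h0, map_zero, mul_zero]; rfl⟩
          · refine ⟨DFinsupp.single ⟨⟨b, p⟩, h0⟩ ⟨e, 1, by simp⟩, ?_⟩
            simp [Φ, φ]
        · refine ⟨0, ?_⟩
          rw [he, ← map_mul, ofVertex, ofPath_mul_ofPath_of_ne (q := ⟨a, b, p⟩) ha, map_zero,
            map_zero]
          rfl
    rintro ⟨x, hx⟩
    have : ∃ f, (Φ f : R) = x := by
      refine TwoSidedIdeal.span_induction_mul (P := fun x => ∃ f, (Φ f : R) = x) ⟨0, by simp⟩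
        ?_ ?_ hx
      · rintro x y ⟨f, rfl⟩ ⟨g, rfl⟩
        exact ⟨f + g, by rw [map_add]; rfl⟩
      · rintro r _ rfl s
        obtain ⟨s, rfl⟩ := hπ.surjective s
        obtain ⟨f, hf⟩ := hmem s
        refine ⟨r • f, ?_⟩
        rw [map_smul, mul_assoc, ← hf]
        rfl
    obtain ⟨f, hf⟩ := this
    exact ⟨f, Subtype.ext hf⟩

theorem isHeredityIdeal_span_ofVertex (hπ : IsMonomialPresentation π) {v : V}
    (hv : ConcatenatesAt π v) :
    IsHeredityIdeal (TwoSidedIdeal.span {π (ofVertex K v)}) := by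
  have hee : π (ofVertex K v) * π (ofVertex K v) = π (ofVertex K v) := by
    rw [← map_mul, ofVertex_mul_self]
  have heL : π (ofVertex K v) ∈ TwoSidedIdeal.span {π (ofVertex K v)} :=
    TwoSidedIdeal.subset_span rfl
  refine ⟨le_antisymm Ideal.mul_le_right ?_, ?_, Or.inl (hπ.projective_span_ofVertex hv)⟩
  · intro x hx
    refine TwoSidedIdeal.span_induction_mul (zero_mem _) (fun x y => add_mem) ?_
      (TwoSidedIdeal.mem_asIdeal.1 hx)
    rintro r _ rfl s
    have h : r * π (ofVertex K v) * s = r * π (ofVertex K v) * (π (ofVertex K v) * s) := by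
      rw [← mul_assoc, mul_assoc r (π _) (π _), hee]
    rw [h]
    exact Ideal.mul_mem_mul (TwoSidedIdeal.mem_asIdeal.2 (TwoSidedIdeal.mul_mem_left _ _ _ heL))
      (TwoSidedIdeal.mem_asIdeal.2 (TwoSidedIdeal.mul_mem_right _ _ _ heL))
  -- the corner `e R e` is `K e`, and `e` does not lie in the radical unless it is zero
  have hcorner : ∀ j ∈ Ring.jacobson R, π (ofVertex K v) * j * π (ofVertex K v) = 0 := by
    intro j hj
    have hej : π (ofVertex K v) * j * π (ofVertex K v) ∈ Ring.jacobson R :=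
      Ideal.mul_mem_right _ _ (Ideal.mul_mem_left _ _ hj)
    obtain ⟨x, rfl⟩ := hπ.surjective j
    obtain ⟨c, hc⟩ := hπ.ofVertex_mul_mul_ofVertex_eq hv x
    rw [map_mul, map_mul] at hc
    rw [hc] at hej ⊢
    by_cases h0 : c = 0
    · rw [h0, zero_smul, map_zero]
    · refine map_smul_eq_zero (IsIdempotentElem.eq_zero_of_mem_jacobson hee ?_)
      have := Ideal.mul_mem_left (Ring.jacobson R) (π (c⁻¹ • 1)) hej
      rwa [← map_mul, smul_mul_assoc, one_mul, smul_smul, inv_mul_cancel₀ h0, one_smul] at this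
  rw [eq_bot_iff]
  have hL : ∀ {x}, x ∈ (TwoSidedIdeal.span {π (ofVertex K v)}).asIdeal →
      ∀ j ∈ Ring.jacobson R, ∀ r : R, x * j * r * π (ofVertex K v) = 0 := by
    intro x hx
    refine TwoSidedIdeal.span_induction_mul (P := fun x => ∀ j ∈ Ring.jacobson R, ∀ r : R,
      x * j * r * π (ofVertex K v) = 0) (by simp) ?_ ?_ (TwoSidedIdeal.mem_asIdeal.1 hx)
    · intro x y hx hy j hj r
      rw [add_mul, add_mul, add_mul, hx j hj r, hy j hj r, add_zero]
    · rintro a _ rfl s j hj r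
      have := hcorner (s * j * r) (Ideal.mul_mem_right _ _ (Ideal.mul_mem_left _ _ hj))
      calc _ = a * (π (ofVertex K v) * (s * j * r) * π (ofVertex K v)) := by noncomm_ring
        _ = 0 := by rw [this, mul_zero]
  refine Submodule.smul_le.2 fun x hx y hy => ?_
  rw [smul_eq_mul, Ideal.mem_bot]
  refine Submodule.smul_induction_on hx (fun a ha j hj => ?_) (fun x x' hx hx' => by
    rw [add_mul, hx, hx', add_zero])
  refine TwoSidedIdeal.span_induction_mul (P := fun y => a • j * y = 0) (mul_zero _)
    (fun y y' hy hy' => by rw [mul_add, hy, hy', add_zero]) ?_ (TwoSidedIdeal.mem_asIdeal.1 hy)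
  rintro r _ rfl s
  rw [smul_eq_mul, ← mul_assoc, ← mul_assoc, hL ha j hj r, zero_mul]

end IsMonomialPresentation

end PathAlgebra

namespace PathAlgebra

variable {K V : Type*} [Field K] [Quiver V] [Fintype V]

/-! ### Factor rings of monomial algebras by vertices -/

theorem ofPath_mem_arrowIdeal_pow (N : ℕ) {p : QPath V} (h : N ≤ p.path.length) :
    ofPath K p ∈ (arrowIdeal K V).asIdeal ^ N := by
  induction N generalizing p with
  | zero => rw [Submodule.pow_zero, Ideal.one_eq_top]; exact Submodule.mem_top
  | succ N ih =>
    obtain ⟨a, b, p⟩ := p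
    cases p with
    | nil => simp at h
    | @cons c _ p e =>
      rw [← Quiver.Path.comp_toPath_eq_cons, ← ofPath_mul_ofPath_of_comp,
        Submodule.pow_succ]
      refine Ideal.mul_mem_mul (ih (p := ⟨a, c, p⟩) ?_) (TwoSidedIdeal.mem_asIdeal.2 ?_)
      · simpa using h
      · exact TwoSidedIdeal.subset_span ⟨_, Quiver.Path.length_toPath e, rfl⟩

theorem ofVertex_notMem_arrowIdeal (v : V) : ofVertex K v ∉ arrowIdeal K V := by
  rw [arrowIdeal, ofVertex, ofPath_mem_pathIdeal]
  rintro ⟨t, ht, h⟩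
  have := h.length_le
  simp only [Set.mem_ofPred_eq] at ht
  simp [ht, QPath.vertex] at this

theorem IsAdmissible.ofVertex_notMem {I : TwoSidedIdeal (PathAlgebra K V)} (hI : IsAdmissible I)
    (v : V) : ofVertex K v ∉ I := by
  intro h
  have h2 : ofVertex K v ∈ (arrowIdeal K V).asIdeal ^ (1 + 1) :=
    hI.2 (TwoSidedIdeal.mem_asIdeal.2 h)
  rw [Submodule.pow_succ] at h2
  exact ofVertex_notMem_arrowIdeal v (TwoSidedIdeal.mem_asIdeal.1 (Ideal.mul_le_right h2))

/-- In a minimal set of paths generating an ideal, no path is a proper subpath of another. -/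
theorem IsMinimalGeneratingSet.eq_of_isSubpath {I : TwoSidedIdeal (PathAlgebra K V)}
    {T : Set (QPath V)} (hT : IsMinimalGeneratingSet I T) {s t : QPath V} (hs : s ∈ T)
    (ht : t ∈ T) (h : QPath.IsSubpath s t) : s = t := by
  by_contra hne
  have hgen : pathIdeal K (T \ {t}) = I := by
    rw [← hT.prop]
    refine le_antisymm (TwoSidedIdeal.span_mono (Set.image_mono Set.sdiff_subset))
      (TwoSidedIdeal.span_le.2 ?_)
    rintro _ ⟨u, hu, rfl⟩
    refine ofPath_mem_pathIdeal.2 ?_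
    by_cases hut : u = t
    · exact ⟨s, ⟨hs, hne⟩, hut ▸ h⟩
    · exact ⟨u, ⟨hu, hut⟩, QPath.IsSubpath.refl u⟩
  exact (hT.le_of_le hgen Set.sdiff_subset ht).2 rfl

/-- The ideal of the algebra `K V / I` that is generated by the vertices in `S`. -/
noncomputable def vertexIdeal (I : TwoSidedIdeal (PathAlgebra K V)) (S : Set V) :
    TwoSidedIdeal (PathAlgebra K V ⧸ I.asIdeal) :=
  TwoSidedIdeal.span ((fun v => Ideal.Quotient.mk I.asIdeal (ofVertex K v)) '' S)

theorem vertexIdeal_mono (I : TwoSidedIdeal (PathAlgebra K V)) {S S' : Set V} (h : S ⊆ S') :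
    vertexIdeal I S ≤ vertexIdeal I S' :=
  TwoSidedIdeal.span_mono (Set.image_mono h)

theorem map_vertexIdeal {R : Type*} [Ring R] (I : TwoSidedIdeal (PathAlgebra K V)) (S : Set V)
    (f : PathAlgebra K V ⧸ I.asIdeal →+* R) : (vertexIdeal I S).map f =
      TwoSidedIdeal.span ((fun v => f (Ideal.Quotient.mk I.asIdeal (ofVertex K v))) '' S) := by
  rw [vertexIdeal, TwoSidedIdeal.map_span, Set.image_image]

/-- The projection of the path algebra `K V` onto the factor ring of `K V / I` by the ideal
generated by the vertices in `S`. -/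
noncomputable def toVertexQuotient (I : TwoSidedIdeal (PathAlgebra K V)) (S : Set V) :
    PathAlgebra K V →+* (PathAlgebra K V ⧸ I.asIdeal) ⧸ (vertexIdeal I S).asIdeal :=
  (Ideal.Quotient.mk (vertexIdeal I S).asIdeal).comp (Ideal.Quotient.mk I.asIdeal)

theorem toVertexQuotient_eq_zero_iff {T : Set (QPath V)} {S : Set V} {x : PathAlgebra K V} :
    toVertexQuotient (pathIdeal K T) S x = 0 ↔
      x ∈ pathIdeal K (T ∪ QPath.vertex '' S) := by
  set I := pathIdeal K T with hI
  set P := pathIdeal K (T ∪ QPath.vertex '' S) with hP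
  constructor
  · intro h
    have hx : Ideal.Quotient.mk I.asIdeal x ∈ vertexIdeal I S := by
      rw [toVertexQuotient, RingHom.comp_apply, Ideal.Quotient.eq_zero_iff_mem] at h
      exact TwoSidedIdeal.mem_asIdeal.1 h
    have hle : I ≤ P := TwoSidedIdeal.span_mono (Set.image_mono Set.subset_union_left)
    have hle' : I.asIdeal ≤ P.asIdeal := fun y hy =>
      TwoSidedIdeal.mem_asIdeal.2 (hle (TwoSidedIdeal.mem_asIdeal.1 hy))
    have : vertexIdeal I S ≤ TwoSidedIdeal.ker (Ideal.Quotient.factor hle') := by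
      refine TwoSidedIdeal.span_le.2 ?_
      rintro _ ⟨v, hv, rfl⟩
      rw [SetLike.mem_coe, TwoSidedIdeal.mem_ker, Ideal.Quotient.factor_mk,
        Ideal.Quotient.eq_zero_iff_mem, TwoSidedIdeal.mem_asIdeal]
      exact TwoSidedIdeal.subset_span ⟨_, Or.inr ⟨v, hv, rfl⟩, rfl⟩
    have := this hx
    rwa [TwoSidedIdeal.mem_ker, Ideal.Quotient.factor_mk,
      Ideal.Quotient.eq_zero_iff_mem, TwoSidedIdeal.mem_asIdeal] at this
  · intro hx
    have : P ≤ TwoSidedIdeal.ker (toVertexQuotient I S) := by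
      refine TwoSidedIdeal.span_le.2 ?_
      rintro _ ⟨t, ht | ⟨v, hv, rfl⟩, rfl⟩ <;>
        rw [SetLike.mem_coe, TwoSidedIdeal.mem_ker, toVertexQuotient, RingHom.comp_apply]
      · have : Ideal.Quotient.mk I.asIdeal (ofPath K t) = 0 := Ideal.Quotient.eq_zero_iff_mem.2
          (TwoSidedIdeal.mem_asIdeal.2 (TwoSidedIdeal.subset_span ⟨t, ht, rfl⟩))
        rw [this, map_zero]
      · rw [Ideal.Quotient.eq_zero_iff_mem, TwoSidedIdeal.mem_asIdeal]
        exact TwoSidedIdeal.subset_span ⟨v, hv, rfl⟩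
    exact (TwoSidedIdeal.mem_ker _).1 (this hx)

theorem toVertexQuotient_ofPath_eq_zero_iff {T : Set (QPath V)} {S : Set V} {p : QPath V} :
    toVertexQuotient (pathIdeal K T) S (ofPath K p) = 0 ↔
      (∃ t ∈ T, QPath.IsSubpath t p) ∨ ∃ v ∈ S, v ∈ p.path.vertices := by
  rw [toVertexQuotient_eq_zero_iff, ofPath_mem_pathIdeal]
  constructor
  · rintro ⟨_, ht | ⟨v, hv, rfl⟩, h⟩
    · exact Or.inl ⟨_, ht, h⟩
    · exact Or.inr ⟨v, hv, QPath.vertex_isSubpath_iff.1 h⟩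
  · rintro (⟨t, ht, h⟩ | ⟨v, hv, h⟩)
    · exact ⟨t, Or.inl ht, h⟩
    · exact ⟨_, Or.inr ⟨v, hv, rfl⟩, QPath.vertex_isSubpath_iff.2 h⟩

theorem isMonomialPresentation_toVertexQuotient {T : Set (QPath V)}
    (hadm : IsAdmissible (pathIdeal K T)) (S : Set V) :
    IsMonomialPresentation (toVertexQuotient (pathIdeal K T) S) where
  surjective := Ideal.Quotient.mk_surjective.comp Ideal.Quotient.mk_surjective
  map_ofPath_eq_zero x hx p hp := by
    rw [toVertexQuotient_eq_zero_iff, mem_pathIdeal] at hx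
    rw [toVertexQuotient_eq_zero_iff, ofPath_mem_pathIdeal]
    exact hx p hp
  exists_length := by
    obtain ⟨⟨N, -, hN⟩, -⟩ := hadm
    refine ⟨N, fun p hp => ?_⟩
    have : Ideal.Quotient.mk (pathIdeal K T).asIdeal (ofPath K p) = 0 :=
      Ideal.Quotient.eq_zero_iff_mem.2 (hN (ofPath_mem_arrowIdeal_pow N hp))
    rw [toVertexQuotient, RingHom.comp_apply, this, map_zero]

/-- If `v` is properly internal to no path of `T` that avoids `S`, then nonzero paths that meet at
`v` have a nonzero concatenation in the factor ring by the vertices in `S`. -/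
theorem concatenatesAt_toVertexQuotient {T : Set (QPath V)} {S : Set V} {v : V}
    (h : ∀ t ∈ QPath.avoiding T S, ¬ QPath.IsProperlyInternal v t) :
    IsMonomialPresentation.ConcatenatesAt (toVertexQuotient (pathIdeal K T) S) v := by
  intro a c p q hp hq
  rw [Ne, toVertexQuotient_ofPath_eq_zero_iff, not_or] at hp hq ⊢
  obtain ⟨hp1, hp2⟩ := hp
  obtain ⟨hq1, hq2⟩ := hq
  have hav : ∀ w ∈ S, w ∉ (p.comp q).vertices := by
    intro w hw hwpq
    rcases (Quiver.Path.mem_vertices_comp p q).1 hwpq with hwp | hwq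
    · exact hp2 ⟨w, hw, hwp⟩
    · exact hq2 ⟨w, hw, hwq⟩
  refine ⟨?_, fun ⟨w, hw, hw'⟩ => hav w hw hw'⟩
  rintro ⟨t, ht, htpq⟩
  rcases htpq.of_comp with htp | htq | hint
  · exact hp1 ⟨t, ht, htp⟩
  · exact hq1 ⟨t, ht, htq⟩
  · exact h t ⟨ht, fun w hw hwt => hav w hw (htpq.mem_vertices hwt)⟩ hint

/-- If nonzero paths that meet at `v` have a nonzero concatenation in the factor ring by the
vertices in `S`, then `v` is properly internal to no path of `T` that avoids `S`: the two parts of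
such a path would be nonzero by the minimality of `T`. -/
theorem not_isProperlyInternal_of_concatenatesAt {I : TwoSidedIdeal (PathAlgebra K V)}
    {T : Set (QPath V)} (hT : IsMinimalGeneratingSet I T) {S : Set V} {v : V}
    (h : IsMonomialPresentation.ConcatenatesAt (toVertexQuotient (pathIdeal K T) S) v)
    {t : QPath V} (ht : t ∈ QPath.avoiding T S) : ¬ QPath.IsProperlyInternal v t := by
  rintro ⟨p, q, hp, hq, hpq⟩
  obtain ⟨a, c, t⟩ := t
  obtain ⟨ht, hav⟩ := ht
  dsimp only at p q hpq hav
  subst hpq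
  refine h p q ?_ ?_
    (toVertexQuotient_ofPath_eq_zero_iff.2 (Or.inl ⟨_, ht, QPath.IsSubpath.refl _⟩)) <;>
    rw [Ne, toVertexQuotient_ofPath_eq_zero_iff] <;>
    rintro (⟨s, hs, hsub⟩ | ⟨w, hw, hw'⟩)
  · have hlen := hsub.length_le
    rw [hT.eq_of_isSubpath hs ht (hsub.trans (QPath.isSubpath_comp_left p q))] at hlen
    simp only [Quiver.Path.length_comp] at hlen
    omega
  · exact hav w hw ((Quiver.Path.mem_vertices_comp p q).2 (Or.inl hw'))
  · have hlen := hsub.length_le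
    rw [hT.eq_of_isSubpath hs ht (hsub.trans (QPath.isSubpath_comp_right p q))] at hlen
    simp only [Quiver.Path.length_comp] at hlen
    omega
  · exact hav w hw ((Quiver.Path.mem_vertices_comp p q).2 (Or.inr hw'))

/-! ### Heredity chains and orderings of the vertices -/

theorem isQuasiHereditary_of_ordering {T : Set (QPath V)} (hadm : IsAdmissible (pathIdeal K T))
    {n : ℕ} (v : Fin n ≃ V)
    (hv : ∀ i : Fin n, ∀ t ∈ QPath.avoiding T {w | ∃ j < i, w = v j},
      ¬ QPath.IsProperlyInternal (v i) t) :
    IsQuasiHereditary (PathAlgebra K V ⧸ (pathIdeal K T).asIdeal) := by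
  let S : ℕ → Set V := fun i => {w | ∃ j : Fin n, (j : ℕ) < i ∧ w = v j}
  refine ⟨n, fun i => vertexIdeal (pathIdeal K T) (S i), ?_, ?_, fun i hi => ?_⟩
  · have : S 0 = ∅ := by simp [S]
    simp only [this, vertexIdeal, Set.image_empty]
    exact le_bot_iff.1 (TwoSidedIdeal.span_le.2 (Set.empty_subset _))
  · rw [← TwoSidedIdeal.one_mem_iff, ← map_one (Ideal.Quotient.mk _), one_def, map_sum]
    refine sum_mem fun w _ => TwoSidedIdeal.subset_span ⟨w, ⟨v.symm w, ?_, ?_⟩, rfl⟩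
    · exact (v.symm w).2
    · simp
  have hle : vertexIdeal (pathIdeal K T) (S i) ≤ vertexIdeal (pathIdeal K T) (S (i + 1)) :=
    vertexIdeal_mono _ fun w ⟨j, hj, hw⟩ => ⟨j, by omega, hw⟩
  refine ⟨hle, ?_⟩
  have hS : S i = {w | ∃ j < (⟨i, hi⟩ : Fin n), w = v j} := by simp [S, Fin.lt_def]
  have hher := (isMonomialPresentation_toVertexQuotient hadm (S i)).isHeredityIdeal_span_ofVertex
    (concatenatesAt_toVertexQuotient (K := K) (by rw [hS]; exact hv ⟨i, hi⟩))
  convert hher using 1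
  rw [map_vertexIdeal]
  refine le_antisymm (TwoSidedIdeal.span_le.2 ?_) (TwoSidedIdeal.span_mono ?_)
  · rintro _ ⟨w, ⟨j, hj, rfl⟩, rfl⟩
    rcases Nat.lt_succ_iff_lt_or_eq.1 hj with hj | hj
    · have : toVertexQuotient (pathIdeal K T) (S i) (ofVertex K (v j)) = 0 :=
        Ideal.Quotient.eq_zero_iff_mem.2 (TwoSidedIdeal.mem_asIdeal.2
          (TwoSidedIdeal.subset_span ⟨_, ⟨j, hj, rfl⟩, rfl⟩))
      have h0 : toVertexQuotient (pathIdeal K T) (S i) (ofVertex K (v j)) ∈ TwoSidedIdeal.span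
          {toVertexQuotient (pathIdeal K T) (S i) (ofVertex K (v ⟨i, hi⟩))} := by
        rw [this]
        exact zero_mem _
      exact h0
    · obtain rfl : j = ⟨i, hi⟩ := Fin.ext hj
      exact TwoSidedIdeal.subset_span rfl
  · rintro _ rfl
    exact ⟨_, ⟨⟨i, hi⟩, Nat.lt_succ_self i, rfl⟩, rfl⟩

/-- One step of a heredity chain: if `P / L` is a heredity ideal and `L` is generated by vertices,
then so is `P`, and nonzero paths of the factor ring by `L` that meet at a vertex of `P` have a
nonzero concatenation. -/
theorem eq_vertexIdeal_and_concatenatesAt {T : Set (QPath V)}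
    (hadm : IsAdmissible (pathIdeal K T)) {S : Set V}
    {L P : TwoSidedIdeal (PathAlgebra K V ⧸ (pathIdeal K T).asIdeal)}
    (hL : L = vertexIdeal (pathIdeal K T) S) (hle : L ≤ P)
    (hP : IsHeredityIdeal (P.map (Ideal.Quotient.mk L.asIdeal))) :
    P = vertexIdeal (pathIdeal K T) {v | Ideal.Quotient.mk _ (ofVertex K v) ∈ P} ∧
      ∀ v, Ideal.Quotient.mk _ (ofVertex K v) ∈ P →
        IsMonomialPresentation.ConcatenatesAt (toVertexQuotient (pathIdeal K T) S) v := by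
  subst hL
  have hπ := isMonomialPresentation_toVertexQuotient hadm S
  have hmem : ∀ v, toVertexQuotient (pathIdeal K T) S (ofVertex K v) ∈
      P.map (Ideal.Quotient.mk (vertexIdeal (pathIdeal K T) S).asIdeal) ↔
        Ideal.Quotient.mk _ (ofVertex K v) ∈ P := fun v => TwoSidedIdeal.mk_mem_map_mk hle
  refine ⟨?_, fun v hv a c p q => hπ.map_comp_ne_zero_of_isHeredityIdeal hP ((hmem v).2 hv) p q⟩
  have hle' : vertexIdeal (pathIdeal K T) S ≤
      vertexIdeal (pathIdeal K T) {v | Ideal.Quotient.mk _ (ofVertex K v) ∈ P} :=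
    vertexIdeal_mono _ fun v hv => hle (TwoSidedIdeal.subset_span ⟨v, hv, rfl⟩)
  refine TwoSidedIdeal.eq_of_map_mk_eq hle hle' ?_
  rw [hπ.eq_span_ofVertex hP.1]
  simp only [hmem]
  rw [map_vertexIdeal]
  rfl

theorem exists_ordering_of_isQuasiHereditary {T : Set (QPath V)}
    (hadm : IsAdmissible (pathIdeal K T)) (hT : IsMinimalGeneratingSet (pathIdeal K T) T)
    (h : IsQuasiHereditary (PathAlgebra K V ⧸ (pathIdeal K T).asIdeal)) :
    ∃ v : Fin (Fintype.card V) ≃ V, ∀ i : Fin (Fintype.card V),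
      ∀ t ∈ QPath.avoiding T {w | ∃ j < i, w = v j}, ¬ QPath.IsProperlyInternal (v i) t := by
  classical
  obtain ⟨n, L, h0, hn, hstep⟩ := h
  let S : ℕ → Set V := fun i => {v | Ideal.Quotient.mk _ (ofVertex K v) ∈ L i}
  have hS0 : ∀ v, v ∉ S 0 := by
    intro v hv
    simp only [S, Set.mem_ofPred_eq] at hv
    rw [h0, TwoSidedIdeal.mem_bot, Ideal.Quotient.eq_zero_iff_mem, TwoSidedIdeal.mem_asIdeal] at hv
    exact hadm.ofVertex_notMem v hv
  have hL : ∀ i ≤ n, L i = vertexIdeal (pathIdeal K T) (S i) := by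
    intro i
    induction i with
    | zero =>
      intro _
      have : S 0 = ∅ := Set.eq_empty_of_forall_notMem hS0
      rw [this, h0, vertexIdeal, Set.image_empty]
      exact (le_bot_iff.1 (TwoSidedIdeal.span_le.2 (Set.empty_subset _))).symm
    | succ i ih =>
      intro hi
      obtain ⟨hle, hher⟩ := hstep i hi
      exact (eq_vertexIdeal_and_concatenatesAt hadm (ih (Nat.le_of_succ_le hi)) hle hher).1
  have hex : ∀ v, ∃ i, v ∈ S i := fun v => ⟨n, by
    simp only [S, Set.mem_ofPred_eq, hn, TwoSidedIdeal.mem_top]⟩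
  -- the vertices are ordered by the first member of the chain that contains them
  let r : V → ℕ := fun v => Nat.find (hex v)
  let e := Fintype.equivFin V
  let f : Fin (Fintype.card V) → ℕ := r ∘ e.symm
  have hmono : Monotone (f ∘ Tuple.sort f) := Tuple.monotone_sort f
  refine ⟨(Tuple.sort f).trans e.symm, fun i t ht => ?_⟩
  set v := ((Tuple.sort f).trans e.symm) i with hv
  have hrv : v ∈ S (r v) := Nat.find_spec (hex v)
  obtain ⟨k, hk⟩ : ∃ k, r v = k + 1 := by
    refine Nat.exists_eq_succ_of_ne_zero fun hr => ?_
    rw [hr] at hrv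
    exact hS0 v hrv
  have hkn : k < n := by
    have : r v ≤ n := Nat.find_min' (hex v) (by
      simp only [S, Set.mem_ofPred_eq, hn, TwoSidedIdeal.mem_top])
    omega
  rw [hk] at hrv
  obtain ⟨hle, hher⟩ := hstep k hkn
  have hcat := (eq_vertexIdeal_and_concatenatesAt hadm (hL k hkn.le) hle hher).2 v hrv
  refine not_isProperlyInternal_of_concatenatesAt hT hcat ⟨ht.1, fun w hw => ?_⟩
  refine ht.2 w ⟨(Tuple.sort f).symm (e w), ?_, by simp⟩
  by_contra hij
  have h1 : r v ≤ r w := by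
    have := hmono (not_lt.1 hij)
    simpa [f, hv] using this
  have h2 : r w ≤ k := Nat.find_min' (hex w) hw
  omega

end PathAlgebra

theorem theoremA {K V : Type*} [Field K] [Quiver V] [Fintype V]
    (I : TwoSidedIdeal (PathAlgebra K V))
    (hfin : Module.Finite K (PathAlgebra K V ⧸ I.asIdeal))
    (hadm : PathAlgebra.IsAdmissible I) (hmon : PathAlgebra.IsMonomial I)
    (T : Set (QPath V)) (hT : PathAlgebra.IsMinimalGeneratingSet I T) :
    IsQuasiHereditary (PathAlgebra K V ⧸ I.asIdeal) ↔
      ∃ v : Fin (Fintype.card V) ≃ V, ∀ i : Fin (Fintype.card V),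
        ∀ t ∈ QPath.avoiding T {w | ∃ j < i, w = v j}, ¬ QPath.IsProperlyInternal (v i) t := by
  obtain rfl : PathAlgebra.pathIdeal K T = I := hT.prop
  exact ⟨PathAlgebra.exists_ordering_of_isQuasiHereditary hadm hT,
    fun ⟨v, hv⟩ => PathAlgebra.isQuasiHereditary_of_ordering hadm v hv⟩
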